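/- Let $K$ be a field and let $B$ be an affine semigroup, that is, a finitely generated submonoid of $(\mathbb Z^n,+)$. For $X\subseteq\mathbb Q^n$ let $C(X)=\{\sum\lambda_i x_i \mid \lambda_i\in\mathbb Q_{\ge 0},\ x_i\in X\}$ be the cone spanned by $X$. Assume that $B$ is simplicial, i.e. there are linearly independent elements $e_1,\dots,e_d\in B$ with $C(\{e_1,\dots,e_d\})=C(B)$, and fix such elements. Let $A$ be the submonoid generated by $e_1,\dots,e_d$, let $G(A)$ be the group generated by $A$, and for $x$ in the linear span of $e_1,\dots,e_d$ write $x=\sum_{i=1}^d\lambda_i^x e_i$ with $\lambda_i^x\in\mathbb Q$. Put $$B_A=\{x\in B \mid x-a\notin B \text{ for all } a\in A\setminus\{0\}\},$$ and let $\Gamma_1,\dots,\Gamma_f$ be the equivalence classes of $B_A$ under the relation $x\sim y :\Leftrightarrow x-y\in G(A)$. Define the shifts $$h_j=\sum_{i=1}^d \min\{\lambda_i^x \mid x\in\Gamma_j\}\, e_i\in\mathbb Z^n\qquad(j=1,\dots,f),$$ and let $\tilde B$ be the submonoid of $\mathbb Z^n$ generated by $e_1,\dots,e_d,h_1,\dots,h_f$.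 For a submonoid $S\subseteq\mathbb Z^n$ let $K[S]$ denote its semigroup ring. **Theorem.** $\tilde B$ is an affine semigroup with $B\subseteq\tilde B\subseteq C(B)$, and the ring $K[\tilde B]$ is Cohen–Macaulay. Moreover, if $\hat B$ is any affine semigroup with $B\subseteq\hat B\subseteq C(B)$ such that $K[\hat B]$ is Cohen–Macaulay, then $\tilde B\subseteq\hat B$. Consequently, $\tilde B$ is the unique minimal element, with respect to inclusion, of the set of affine semigroups $\hat B$ with $B\subseteq\hat B\subseteq C(B)$ and $K[\hat B]$ Cohen–Macaulay. -/

import Mathlib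

/-! ### Cohen-Macaulay rings -/

/-- The depth of a local ring: the supremum of the lengths of the regular sequences contained in
its maximal ideal. -/
noncomputable def localDepth (R : Type*) [CommRing R] [IsLocalRing R] : ℕ∞ :=
  ⨆ (rs : List R) (_ : (∀ r ∈ rs, r ∈ IsLocalRing.maximalIdeal R) ∧
    RingTheory.Sequence.IsRegular R rs), (rs.length : ℕ∞)

/-- A commutative ring is Cohen-Macaulay if it is Noetherian and if each of its localizations
at a maximal ideal has depth equal to its Krull dimension. -/
structure IsCohenMacaulayRing (R : Type*) [CommRing R] : Prop where
  isNoetherianRing : IsNoetherianRing R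
  depth_eq_dim : ∀ (m : Ideal R) [m.IsMaximal],
    (localDepth (Localization.AtPrime m) : WithBot ℕ∞) = ringKrullDim (Localization.AtPrime m)

/-! ### Simplicial affine semigroups -/

namespace SimplicialSemigroup

variable {n d : ℕ}

/-- The embedding of `ℤ ^ n` into `ℚ ^ n`. -/
def toRat (x : Fin n → ℤ) : Fin n → ℚ := fun i => (x i : ℚ)

/-- The cone `C(X)` in `ℚ ^ n` spanned by a subset `X` of `ℤ ^ n`: the set of all linear
combinations of elements of `X` with nonnegative rational coefficients. -/
def cone (X : Set (Fin n → ℤ)) : PointedCone ℚ (Fin n → ℚ) :=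
  PointedCone.hull ℚ (toRat '' X)

/-- `e_1, …, e_d` are linearly independent elements of `B` that span the cone `C(B)`.
An affine semigroup is simplicial if such elements exist. -/
structure IsSimplicialFrame (B : AddSubmonoid (Fin n → ℤ)) (e : Fin d → Fin n → ℤ) : Prop where
  mem : ∀ i, e i ∈ B
  linearIndependent : LinearIndependent ℚ fun i => toRat (e i)
  cone_eq : cone (Set.range e) = cone (B : Set (Fin n → ℤ))

/-- The submonoid `A` generated by `e_1, …, e_d`. -/
def freePart (e : Fin d → Fin n → ℤ) : AddSubmonoid (Fin n → ℤ) :=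
  AddSubmonoid.closure (Set.range e)

/-- The set `B_A` of all `x ∈ B` such that `x - a ∉ B` for all `a ∈ A` with `a ≠ 0`. -/
def apery (B : AddSubmonoid (Fin n → ℤ)) (e : Fin d → Fin n → ℤ) : Set (Fin n → ℤ) :=
  {x | x ∈ B ∧ ∀ a ∈ freePart e, a ≠ 0 → x - a ∉ B}

/-- The equivalence relation `x ∼ y`: the difference lies in the group `G(A)` generated by `A`. -/
def Equivalent (e : Fin d → Fin n → ℤ) (x y : Fin n → ℤ) : Prop :=
  x - y ∈ AddSubgroup.closure (freePart e : Set (Fin n → ℤ))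

/-- The equivalence class of `y` inside `B_A`. -/
def aperyClass (B : AddSubmonoid (Fin n → ℤ)) (e : Fin d → Fin n → ℤ) (y : Fin n → ℤ) :
    Set (Fin n → ℤ) :=
  {x | x ∈ apery B e ∧ Equivalent e x y}

/-- `c` is the vector `(λ_1^x, …, λ_d^x)` of rational coordinates of `x`, that is,
`x = ∑ i, λ_i^x e_i`. It is unique when the `e_i` are linearly independent. -/
def IsCoords (e : Fin d → Fin n → ℤ) (x : Fin n → ℤ) (c : Fin d → ℚ) : Prop :=
  toRat x = ∑ i, c i • toRat (e i)

/-- `h` is the shift of the class `Γ`, that is, `h = ∑ i, min {λ_i^x | x ∈ Γ} e_i`. -/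
def IsShift (e : Fin d → Fin n → ℤ) (Γ : Set (Fin n → ℤ)) (h : Fin n → ℤ) : Prop :=
  ∃ μ : Fin d → ℚ, IsCoords e h μ ∧
    ∀ i, IsLeast {q : ℚ | ∃ x ∈ Γ, ∃ c, IsCoords e x c ∧ c i = q} (μ i)

/-- The set `{h_1, …, h_f}` of the shifts of all equivalence classes in `B_A`. -/
def shifts (B : AddSubmonoid (Fin n → ℤ)) (e : Fin d → Fin n → ℤ) : Set (Fin n → ℤ) :=
  {h | ∃ y ∈ apery B e, IsShift e (aperyClass B e y) h}

/-- The semigroup generated by `e_1, …, e_d` and the shifts `h_1, …, h_f`. -/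
def tilde (B : AddSubmonoid (Fin n → ℤ)) (e : Fin d → Fin n → ℤ) : AddSubmonoid (Fin n → ℤ) :=
  AddSubmonoid.closure (Set.range e ∪ shifts B e)

/-- `B'` is an affine semigroup with `B ⊆ B' ⊆ C(B)` such that the semigroup ring `K[B']` is
Cohen-Macaulay. -/
structure IsCMExtension (K : Type*) [Field K] (B B' : AddSubmonoid (Fin n → ℤ)) : Prop where
  fg : B'.FG
  le : B ≤ B'
  subset_cone : ∀ x ∈ B', toRat x ∈ cone (B : Set (Fin n → ℤ))
  isCohenMacaulay : IsCohenMacaulayRing (AddMonoidAlgebra K B')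

/-! Each class in `B_A` has exactly one shift, so that `IsShift` does define `h_j ∈ ℤ ^ n`. -/

theorem toRat_add (x y : Fin n → ℤ) : toRat (x + y) = toRat x + toRat y := by
  ext i; simp [toRat]

theorem toRat_sum_smul (z : Fin d → ℤ) (e : Fin d → Fin n → ℤ) :
    toRat (∑ i, z i • e i) = ∑ i, (z i : ℚ) • toRat (e i) := by
  ext k; simp [toRat, Finset.sum_apply]

theorem toRat_injective : Function.Injective (toRat : (Fin n → ℤ) → Fin n → ℚ) := by
  intro x y h
  ext i
  have := congrFun h i
  simpa [toRat] using this

theorem IsCoords.unique {B : AddSubmonoid (Fin n → ℤ)} {e : Fin d → Fin n → ℤ}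
    (he : IsSimplicialFrame B e) {x : Fin n → ℤ} {c c' : Fin d → ℚ}
    (h : IsCoords e x c) (h' : IsCoords e x c') : c = c' := by
  have h1 := Fintype.linearIndependent_iff.1 he.linearIndependent (fun i => c i - c' i) (by
    simp only [sub_smul, Finset.sum_sub_distrib]
    rw [← h, ← h', sub_self])
  funext i
  exact sub_eq_zero.1 (h1 i)

theorem exists_coords {B : AddSubmonoid (Fin n → ℤ)} {e : Fin d → Fin n → ℤ}
    (he : IsSimplicialFrame B e) {x : Fin n → ℤ} (hx : x ∈ B) :
    ∃ c, IsCoords e x c ∧ ∀ i, 0 ≤ c i := by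
  have h1 : toRat x ∈ cone (Set.range e) := by
    rw [he.cone_eq]
    exact Submodule.subset_span ⟨x, hx, rfl⟩
  have h2 : toRat x ∈ Submodule.span {c : ℚ // 0 ≤ c} (Set.range fun i => toRat (e i)) := by
    have : (toRat '' Set.range e) = Set.range fun i => toRat (e i) := by
      rw [← Set.range_comp]; rfl
    rw [← this]
    exact h1
  obtain ⟨c, hc⟩ := (Submodule.mem_span_range_iff_exists_fun _).1 h2
  exact ⟨fun i => (c i : ℚ), hc.symm, fun i => (c i).2⟩

theorem Equivalent.exists_int {e : Fin d → Fin n → ℤ} {x y : Fin n → ℤ}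
    (h : Equivalent e x y) : ∃ z : Fin d → ℤ, x = y + ∑ i, z i • e i := by
  have h1 : AddSubgroup.closure (freePart e : Set (Fin n → ℤ)) ≤
      (Submodule.span ℤ (Set.range e)).toAddSubgroup := by
    rw [AddSubgroup.closure_le]
    intro a ha
    exact (AddSubmonoid.closure_le (S := (Submodule.span ℤ (Set.range e)).toAddSubmonoid)).2
      Submodule.subset_span ha
  obtain ⟨z, hz⟩ := (Submodule.mem_span_range_iff_exists_fun ℤ).1 (h1 h)
  exact ⟨z, by rw [hz]; abel⟩

theorem existsUnique_isShift {B : AddSubmonoid (Fin n → ℤ)} {e : Fin d → Fin n → ℤ}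
    (he : IsSimplicialFrame B e) {y : Fin n → ℤ} (hy : y ∈ apery B e) :
    ∃! h, IsShift e (aperyClass B e y) h := by
  obtain ⟨b, hb, -⟩ := exists_coords he hy.1
  have hco : ∀ z : Fin d → ℤ, IsCoords e (y + ∑ i, z i • e i) (fun i => b i + z i) := by
    intro z
    unfold IsCoords at hb ⊢
    rw [toRat_add, toRat_sum_smul, hb]
    simp only [add_smul, Finset.sum_add_distrib]
  have hmin : ∀ i, ∃ m : ℤ, (∃ z : Fin d → ℤ, y + ∑ j, z j • e j ∈ aperyClass B e y ∧ z i = m) ∧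
      ∀ m' : ℤ, (∃ z : Fin d → ℤ, y + ∑ j, z j • e j ∈ aperyClass B e y ∧ z i = m') → m ≤ m' := by
    intro i
    apply Int.exists_least_of_bdd
    · refine ⟨⌊-b i⌋, ?_⟩
      rintro m ⟨z, hz, rfl⟩
      obtain ⟨c, hc, hc0⟩ := exists_coords he hz.1.1
      have h0 := hc0 i
      rw [hc.unique he (hco z)] at h0
      exact_mod_cast (Int.floor_le (-b i)).trans (by linarith : -b i ≤ (z i : ℚ))
    · refine ⟨0, 0, ⟨by simpa using hy, ?_⟩, rfl⟩
      simp [Equivalent]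
  choose m hm hm' using hmin
  refine ⟨y + ∑ i, m i • e i, ⟨fun i => b i + m i, hco m, fun i => ⟨?_, ?_⟩⟩, ?_⟩
  · obtain ⟨z, hz, hzi⟩ := hm i
    exact ⟨_, hz, _, hco z, by simp [hzi]⟩
  · rintro q ⟨x, hx, c, hc, rfl⟩
    obtain ⟨z, rfl⟩ := hx.2.exists_int
    rw [hc.unique he (hco z)]
    have := hm' i (z i) ⟨z, hx, rfl⟩
    simpa using this
  · rintro h ⟨μ, hμ, hμ'⟩
    apply toRat_injective
    have hμm : μ = fun i => b i + m i := by
      funext i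
      refine (hμ' i).unique ⟨?_, ?_⟩
      · obtain ⟨z, hz, hzi⟩ := hm i
        exact ⟨_, hz, _, hco z, by simp [hzi]⟩
      · rintro q ⟨x, hx, c, hc, rfl⟩
        obtain ⟨z, rfl⟩ := hx.2.exists_int
        rw [hc.unique he (hco z)]
        have := hm' i (z i) ⟨z, hx, rfl⟩
        simpa using this
    rw [show toRat h = _ from hμ, hμm]
    exact (hco m).symm

end SimplicialSemigroup

/-! Every element of `B` is an Apéry element plus an element of `A`, and the elements of `B` in the
class of `Γ_j` all lie in `h_j + A`. A sum `h_j + h_k` again lies in some `h_l + A`: in each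
coordinate the two minima are attained by elements of `B`, whose sum lies above `h_l`. Hence `tilde
B e` is the disjoint union of the finitely many translates `h_j + A`, so its semigroup ring is
finite and free over a polynomial ring in `d` variables, and therefore Cohen-Macaulay
(`isCMExtension_tilde`).

Conversely, let `S` lie between `B` and the cone, with Cohen-Macaulay semigroup ring. If `x + e i`
and `x + e j` lie in `S` but `x` does not, then `t^(e j)` is a zero divisor modulo `t^(e i)`. At the
irrelevant ideal the depth is at least `d`, so some prime containing both monomials has coheight at
least `d - 1`. Modulo that prime the other `d - 2` frame monomials generate an ideal primary to the
maximal ideal, which contradicts Krull's height theorem. So `x` lies in `S` (`mem_of_add_mem`).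
Consequently `S` is closed under coordinatewise minima of equivalent elements, and the shifts are
such minima (`tilde_le`). -/

/-! ### Depth and coheight of associated primes -/

section

open RingTheory.Sequence CategoryTheory Abelian IsLocalRing Pointwise ModuleCat

universe w

/-- The length of a regular sequence on `M` is at most the coheight of any associated prime. -/
theorem length_le_ringKrullDim_quotient_of_isAssociatedPrime {R : Type*} [CommRing R]
    [IsLocalRing R] [IsNoetherianRing R] {rs : List R} {M : Type*} [AddCommGroup M] [Module R M]
    [Module.Finite R M] (hrs : IsRegular M rs) (hmem : ∀ r ∈ rs, r ∈ maximalIdeal R)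
    {P : Ideal R} (hP : P ∈ associatedPrimes R M) :
    (rs.length : WithBot ℕ∞) ≤ ringKrullDim (R ⧸ P) := by
  induction rs generalizing M P with
  | nil =>
    have := hP.isPrime
    simpa using ringKrullDim_nonneg_of_nontrivial
  | cons x rs ih =>
    have hPp := hP.isPrime
    obtain ⟨hx, hrs'⟩ := (isRegular_cons_iff _ _ _).1 hrs
    -- `U`, the elements killed by `P`, is nonzero as `P` is associated. If `U` were inside `x M`,
    -- regularity of `x` would give `U = x U`, against Nakayama.
    let U : Submodule R M := Submodule.torsionBySet R M P
    have hU : U ≠ ⊥ := by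
      obtain ⟨-, u, hu⟩ := isAssociatedPrime_iff.1 hP
      refine fun h => hPp.ne_top ((Ideal.eq_top_iff_one P).2 ?_)
      have hu' : u ∈ U := by
        rw [Submodule.mem_torsionBySet_iff]
        rintro ⟨a, ha⟩
        rw [hu] at ha
        simpa [Submodule.mem_colon_singleton] using ha
      rw [h, Submodule.mem_bot] at hu'
      rw [hu, hu']
      simp
    have hUx : ¬ U ≤ x • (⊤ : Submodule R M) := by
      intro h
      refine hU (Submodule.eq_bot_of_le_smul_of_le_jacobson_bot (Ideal.span {x}) U
        (IsNoetherian.noetherian U) (fun u hu => ?_) ?_)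
      · obtain ⟨v, -, rfl⟩ := h hu
        refine Submodule.smul_mem_smul (Ideal.mem_span_singleton_self x) ?_
        rw [Submodule.mem_torsionBySet_iff] at hu ⊢
        intro a
        refine hx ?_
        have := hu a
        change (a : R) • x • v = 0 at this
        change x • (a : R) • v = x • (0 : M)
        rw [smul_comm, this, smul_zero]
      · rw [IsLocalRing.jacobson_eq_maximalIdeal _ bot_ne_top, Ideal.span_singleton_le_iff_mem]
        exact hmem x List.mem_cons_self
    obtain ⟨u, huU, hux⟩ := Set.not_subset.1 hUx
    -- The class of `u` in `M / x M` is nonzero and killed by both `P` and `x`.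
    obtain ⟨Q, hQ, hPQ⟩ : ∃ Q ∈ associatedPrimes R (QuotSMulTop x M), P ⊔ Ideal.span {x} ≤ Q := by
      have hu0 : (Submodule.Quotient.mk u : QuotSMulTop x M) ≠ 0 := by
        rwa [ne_eq, Submodule.Quotient.mk_eq_zero]
      obtain ⟨Q, hQ, hle⟩ := exists_le_isAssociatedPrime_of_isNoetherianRing R _ hu0
      refine ⟨Q, hQ, le_trans (sup_le (fun a ha => ?_) ?_) hle⟩
      · rw [Submodule.mem_colon_singleton, Submodule.mem_bot, ← Submodule.Quotient.mk_smul,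
          (Submodule.mem_torsionBySet_iff _ _).1 huU ⟨a, ha⟩, Submodule.Quotient.mk_zero]
      · rw [Ideal.span_singleton_le_iff_mem, Submodule.mem_colon_singleton, Submodule.mem_bot,
          ← Submodule.Quotient.mk_smul, Submodule.Quotient.mk_eq_zero]
        exact Submodule.smul_mem_pointwise_smul _ _ _ trivial
    have hxP : x ∉ P := by
      intro h
      have : x ∈ ({r : R | IsSMulRegular M r}ᶜ : Set R) := by
        rw [← biUnion_associatedPrimes_eq_compl_regular R M]
        exact Set.mem_biUnion hP h
      exact this hx
    have hQp := hQ.isPrime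
    have hdim : ringKrullDim (R ⧸ Q) + 1 ≤ ringKrullDim (R ⧸ P) := by
      refine ringKrullDim_succ_le_of_surjective (Ideal.Quotient.factor (le_sup_left.trans hPQ))
        (Ideal.Quotient.factor_surjective _) (r := Ideal.Quotient.mk P x) ?_ ?_
      · rwa [mem_nonZeroDivisors_iff_ne_zero, ne_eq, Ideal.Quotient.eq_zero_iff_mem]
      · rw [Ideal.Quotient.factor_mk, Ideal.Quotient.eq_zero_iff_mem]
        exact hPQ (le_sup_right (a := P) (Ideal.mem_span_singleton_self x))
    rw [List.length_cons]
    push_cast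
    exact (add_le_add_left (ih hrs' (fun r hr => hmem r (List.mem_cons_of_mem _ hr)) hQ) 1).trans
      hdim

/-- Dividing out a regular element of the maximal ideal lowers the depth by at most one. -/
theorem exists_isRegular_quotSMulTop {R : Type w} [CommRing R] [IsLocalRing R] [IsNoetherianRing R]
    {M : Type w} [AddCommGroup M] [Module R M] [Module.Finite R M] {x : R}
    (hx : x ∈ maximalIdeal R) (hreg : IsSMulRegular M x) {rs : List R} {k : ℕ}
    (hk : k + 1 ≤ rs.length) (hrs : IsRegular M rs) (hmem : ∀ r ∈ rs, r ∈ maximalIdeal R) :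
    ∃ ss : List R, ss.length = k ∧ (∀ s ∈ ss, s ∈ maximalIdeal R) ∧
      IsRegular (QuotSMulTop x M) ss := by
  have : Nontrivial M := hrs.nontrivial
  have : Nontrivial (QuotSMulTop x M) := nontrivial_quotSMulTop_of_mem_maximalIdeal M hx
  have lt (N : Type w) [AddCommGroup N] [Module R N] [Module.Finite R N] [Nontrivial N] :
      maximalIdeal R • (⊤ : Submodule R N) < ⊤ :=
    (Submodule.top_ne_ideal_smul_of_le_jacobson_annihilator
      (maximalIdeal_le_jacobson _)).symm.lt_top
  -- The given sequence need not start with `x`, so depth is measured by vanishing of Ext from the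
  -- residue field. In the long exact sequence, `Ext^i(N, M/xM)` sits between `Ext^i(N, M)` and
  -- `Ext^(i+1)(N, M)`.
  let N := ModuleCat.of R (R ⧸ maximalIdeal R)
  have supp : Module.support R N = PrimeSpectrum.zeroLocus (maximalIdeal R) := by
    rw [Module.support_eq_zeroLocus]
    simp only [N]
    rw [Ideal.annihilator_quotient]
  have h1 : ∀ i < k + 1, Subsingleton (Ext N (ModuleCat.of R M) i) := by
    exact fun i hi => subsingleton_ext_of_exists_isRegular (maximalIdeal R) N supp.subset
      (ModuleCat.of R M) (lt M) rs hmem hrs i (hi.trans_le hk)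
  refine exists_isRegular_of_exists_subsingleton_ext (maximalIdeal R) k
    (ModuleCat.of R (QuotSMulTop x M)) (lt _) N supp fun i hi => ?_
  have zero1 := AddCommGrpCat.isZero_of_iff_subsingleton.mpr (h1 i (by omega))
  have zero2 := AddCommGrpCat.isZero_of_iff_subsingleton.mpr (h1 (i + 1) (by omega))
  exact AddCommGrpCat.subsingleton_of_isZero <| ShortComplex.Exact.isZero_of_both_zeros
    ((Ext.covariant_sequence_exact₃' N
      (IsSMulRegular.smulShortComplex_shortExact (M := ModuleCat.of R M) hreg)) i (i + 1) rfl)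
    (zero1.eq_zero_of_src _) (zero2.eq_zero_of_tgt _)

/-- If `y` is a zero divisor modulo the nonzerodivisor `x`, then some prime ideal containing
`x` and `y` has coheight at least `depth R - 1`. -/
theorem exists_isPrime_localDepth_le {R : Type w} [CommRing R] [IsLocalRing R] [IsNoetherianRing R]
    {x y u : R} (hx : x ∈ maximalIdeal R) (hreg : IsSMulRegular R x)
    (hyu : y * u ∈ Ideal.span {x}) (hu : u ∉ Ideal.span {x}) {k : ℕ}
    (hk : ((k + 1 : ℕ) : ℕ∞) ≤ localDepth R) :
    ∃ P : Ideal R, P.IsPrime ∧ x ∈ P ∧ y ∈ P ∧ (k : WithBot ℕ∞) ≤ ringKrullDim (R ⧸ P) := by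
  obtain ⟨rs, hlen, hmem, hrs⟩ : ∃ rs : List R, k + 1 ≤ rs.length ∧
      (∀ r ∈ rs, r ∈ maximalIdeal R) ∧ IsRegular R rs := by
    by_contra! h
    have : localDepth R ≤ k := by
      refine iSup₂_le fun rs hrs => ?_
      by_contra! hlt
      refine h rs ?_ hrs.1 hrs.2
      exact_mod_cast hlt
    have := hk.trans this
    norm_cast at this
    omega
  obtain ⟨ss, hss, hsmem, hsreg⟩ := exists_isRegular_quotSMulTop hx hreg hlen hrs hmem
  have hmk (a : R) : (Submodule.Quotient.mk a : QuotSMulTop x R) = 0 ↔ a ∈ Ideal.span {x} := by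
    rw [Submodule.Quotient.mk_eq_zero, Submodule.mem_smul_pointwise_iff_exists,
      Ideal.mem_span_singleton']
    simp [mul_comm]
  -- Both `x` and `y` annihilate the nonzero class of `u`, so an associated prime above its
  -- annihilator contains them.
  obtain ⟨P, hP, hle⟩ := exists_le_isAssociatedPrime_of_isNoetherianRing R
    (Submodule.Quotient.mk u : QuotSMulTop x R) (by rwa [ne_eq, hmk])
  refine ⟨P, hP.isPrime, hle ?_, hle ?_, hss ▸
    length_le_ringKrullDim_quotient_of_isAssociatedPrime hsreg hsmem hP⟩
  · rw [Submodule.mem_colon_singleton, Submodule.mem_bot, ← Submodule.Quotient.mk_smul, hmk,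
      smul_eq_mul]
    exact Ideal.mul_mem_right _ _ (Ideal.mem_span_singleton_self x)
  · rwa [Submodule.mem_colon_singleton, Submodule.mem_bot, ← Submodule.Quotient.mk_smul, hmk]

end

/-! ### Finite free algebras over polynomial rings -/

section

open RingTheory.Sequence IsLocalRing Pointwise

/-- The length of a regular sequence on a Noetherian local ring is at most its dimension. -/
theorem localDepth_le_ringKrullDim (R : Type*) [CommRing R] [IsLocalRing R] [IsNoetherianRing R] :
    (localDepth R : WithBot ℕ∞) ≤ ringKrullDim R := by
  have h0 : (0 : WithBot ℕ∞) ≤ ringKrullDim R := ringKrullDim_nonneg_of_nontrivial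
  obtain ⟨D, hD⟩ := WithBot.ne_bot_iff_exists.1 (ne_bot_of_le_ne_bot WithBot.coe_ne_bot h0)
  rw [← hD, WithBot.coe_le_coe]
  refine iSup₂_le fun rs hrs => ?_
  rw [← WithBot.coe_le_coe, hD, ← ringKrullDim_add_length_eq_ringKrullDim_of_isRegular rs hrs.2]
  have : Nontrivial (R ⧸ Ideal.ofList rs) := by
    refine Ideal.Quotient.nontrivial_iff.2 fun h => hrs.2.2 ?_
    rw [h]; simp
  exact le_add_of_nonneg_left ringKrullDim_nonneg_of_nontrivial

/-- Krull dimension does not grow along an integral extension. -/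
theorem ringKrullDim_le_of_isIntegral (S R : Type*) [CommRing S] [CommRing R] [Algebra S R]
    [Algebra.IsIntegral S R] : ringKrullDim R ≤ ringKrullDim S := by
  refine Order.krullDim_le_of_strictMono
    (fun p : PrimeSpectrum R => PrimeSpectrum.comap (algebraMap S R) p) fun p q h => ?_
  exact Ideal.IsIntegral.comap_lt_comap (I := p.asIdeal) (J := q.asIdeal) h

/-- A weakly regular sequence on the ring stays weakly regular on a flat module. -/
theorem RingTheory.Sequence.IsWeaklyRegular.of_flat_module {R M : Type*} [CommRing R]
    [AddCommGroup M] [Module R M] [Module.Flat R M] {rs : List R} (h : IsWeaklyRegular R rs) :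
    IsWeaklyRegular M rs :=
  ((TensorProduct.rid R M).isWeaklyRegular_congr rs).1 (IsWeaklyRegular.isWeaklyRegular_lTensor (M₂ := M) h)

/-- A monic `g` is a nonzerodivisor and `T[X] / (g)` is free over `T`, so the sequence `ts` stays
weakly regular on it. -/
theorem Polynomial.Monic.isWeaklyRegular_cons {T : Type*} [CommRing T] {g : Polynomial T}
    (hg : g.Monic) {ts : List T} (h : IsWeaklyRegular T ts) :
    IsWeaklyRegular (Polynomial T) (g :: ts.map (algebraMap T (Polynomial T))) := by
  refine IsWeaklyRegular.cons (Module.Flat.isSMulRegular_of_nonZeroDivisors hg.mem_nonZeroDivisors)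
    ?_
  rw [isWeaklyRegular_map_algebraMap_iff]
  have hfree : Module.Free T (Polynomial T ⧸ Ideal.span {g}) := hg.free_quotient
  have e : (Polynomial T ⧸ Ideal.span {g}) ≃ₗ[T] QuotSMulTop g (Polynomial T) :=
    (Submodule.quotEquivOfEq _ _ (by
      rw [← Submodule.ideal_span_singleton_smul]; simp)).restrictScalars T
  have := Module.Free.of_equiv e
  exact h.of_flat_module

/-- Monic univariate polynomials in distinct variables form a regular sequence. -/
theorem MvPolynomial.isWeaklyRegular_ofFn_aeval {K : Type*} [Field K] {d : ℕ}
    (f : Fin d → Polynomial K) (hf : ∀ i, (f i).Monic) :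
    IsWeaklyRegular (MvPolynomial (Fin d) K)
      (List.ofFn fun i => Polynomial.aeval (MvPolynomial.X i : MvPolynomial (Fin d) K) (f i)) := by
  induction d with
  | zero => simp
  | succ d ih =>
    have h := Polynomial.Monic.isWeaklyRegular_cons
      ((hf 0).map (algebraMap K (MvPolynomial (Fin d) K))) (ih (fun i => f i.succ) fun i => hf _)
    -- Singling out the variable `0` makes `f 0` monic in the outer variable and the remaining
    -- polynomials constants.
    let e := MvPolynomial.finSuccEquiv K d
    refine ((AddEquiv.isWeaklyRegular_congr (e := e.toAddEquiv) ?_).2 h)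
    rw [List.ofFn_succ]
    refine List.Forall₂.cons (fun x => ?_) ?_
    · change e (Polynomial.aeval (MvPolynomial.X 0) (f 0) * x) = _ * e x
      rw [map_mul, ← Polynomial.aeval_algHom_apply, MvPolynomial.finSuccEquiv_X_zero,
        Polynomial.aeval_X_left_eq_map]
    · rw [List.map_ofFn, List.forall₂_iff_get]
      refine ⟨by simp, fun i h1 h2 x => ?_⟩
      rw [List.length_ofFn] at h1
      simp only [List.get_eq_getElem, List.getElem_ofFn, Function.comp_apply]
      change e (Polynomial.aeval (MvPolynomial.X (Fin.succ ⟨i, h1⟩)) (f (Fin.succ ⟨i, h1⟩)) * x) =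
        _ * e x
      rw [map_mul, ← Polynomial.aeval_algHom_apply, MvPolynomial.finSuccEquiv_X_succ,
        ← Polynomial.algebraMap_eq, Polynomial.aeval_algebraMap_apply]

/-- An algebra that is finite and free over a polynomial ring is Cohen-Macaulay. -/
theorem IsCohenMacaulayRing.of_free_mvPolynomial (K : Type*) [Field K] (d : ℕ) (R : Type*)
    [CommRing R] [Algebra (MvPolynomial (Fin d) K) R] [Module.Finite (MvPolynomial (Fin d) K) R]
    [Module.Free (MvPolynomial (Fin d) K) R] : IsCohenMacaulayRing R := by
  let S := MvPolynomial (Fin d) K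
  have hN : IsNoetherianRing R := IsNoetherianRing.of_finite S R
  refine ⟨hN, fun m hm => ?_⟩
  have hp : (m.comap (algebraMap S R)).IsMaximal :=
    Ideal.isMaximal_comap_of_isIntegral_of_isMaximal m
  set p := m.comap (algebraMap S R) with hpdef
  -- By the Nullstellensatz each variable is algebraic over `K` modulo `p`; this puts a monic
  -- polynomial in each variable inside `p`, without assuming `K` algebraically closed.
  have hfin : Module.Finite K (S ⧸ p) := by
    let := Ideal.Quotient.field p
    exact finite_of_finite_type_of_isJacobsonRing K (S ⧸ p)
  have hf (i : Fin d) : ∃ f : Polynomial K, f.Monic ∧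
      Polynomial.aeval (MvPolynomial.X i : S) f ∈ p := by
    obtain ⟨f, hf, hf0⟩ := Algebra.IsIntegral.isIntegral (R := K)
      (Ideal.Quotient.mkₐ K p (MvPolynomial.X i))
    refine ⟨f, hf, ?_⟩
    rw [← Ideal.Quotient.eq_zero_iff_mem, ← Ideal.Quotient.mkₐ_eq_mk K,
      ← Polynomial.aeval_algHom_apply]
    exact hf0
  choose f hf hfp using hf
  have hreg : IsRegular (Localization.AtPrime m) _ :=
    (MvPolynomial.isWeaklyRegular_ofFn_aeval f hf).of_flat (S := R)
      |>.isRegular_of_isLocalization_of_mem (Localization.AtPrime m) m (by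
        simp only [List.mem_map, List.mem_ofFn]
        rintro _ ⟨_, ⟨i, rfl⟩, rfl⟩
        exact hfp i)
  refine le_antisymm (localDepth_le_ringKrullDim _) ?_
  -- The dimension is at most `d` by integrality, and the sequence `hreg` has length `d`.
  calc ringKrullDim (Localization.AtPrime m) = m.height :=
        IsLocalization.AtPrime.ringKrullDim_eq_height m _
    _ ≤ ringKrullDim R := Ideal.height_le_ringKrullDim_of_isPrime
    _ ≤ ringKrullDim S := ringKrullDim_le_of_isIntegral S R
    _ = ((d : ℕ∞) : WithBot ℕ∞) := by
      rw [MvPolynomial.ringKrullDim_of_isNoetherianRing, ringKrullDim_eq_zero_of_field]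
      simp
    _ ≤ localDepth (Localization.AtPrime m) := by
      rw [WithBot.coe_le_coe]
      refine le_trans (by simp) (le_iSup₂ (f := fun (rs : List (Localization.AtPrime m)) (_ : (∀ r ∈ rs,
        r ∈ maximalIdeal (Localization.AtPrime m)) ∧ IsRegular (Localization.AtPrime m) rs) =>
          (rs.length : ℕ∞)) _ ⟨?_, hreg⟩)
      simp only [List.mem_map, List.mem_ofFn]
      rintro _ ⟨_, ⟨_, ⟨i, rfl⟩, rfl⟩, rfl⟩
      exact (IsLocalization.AtPrime.to_map_mem_maximal_iff (Localization.AtPrime m) m _).2 (hfp i)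

end

/-! ### Frame coordinates and face primes -/

namespace SimplicialSemigroup

variable {n d : ℕ} {S : AddSubmonoid (Fin n → ℤ)} {e : Fin d → Fin n → ℤ}

/-- The coordinates are extended linearly from the span to all of `ℚ ^ n`. The choice off the span
is arbitrary and harmless. -/
theorem IsSimplicialFrame.exists_dual (he : IsSimplicialFrame S e) :
    ∃ g : (Fin n → ℚ) →ₗ[ℚ] (Fin d →₀ ℚ), ∀ i, g (toRat (e i)) = Finsupp.single i 1 := by
  obtain ⟨g, hg⟩ := LinearMap.exists_extend he.linearIndependent.repr
  refine ⟨g, fun i => ?_⟩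
  have := LinearMap.congr_fun hg ⟨_, Submodule.subset_span (Set.mem_range_self i)⟩
  rw [he.linearIndependent.repr_eq_single i _ rfl] at this
  exact this

/-- The `i`-th coordinate with respect to the frame, extended to an additive map on `ℤ ^ n`. -/
noncomputable def IsSimplicialFrame.coord (he : IsSimplicialFrame S e) (i : Fin d) :
    (Fin n → ℤ) →+ ℚ where
  toFun x := he.exists_dual.choose (toRat x) i
  map_zero' := by
    rw [show toRat (0 : Fin n → ℤ) = 0 by ext; simp [toRat]]
    simp
  map_add' x y := by simp [toRat_add]

theorem IsSimplicialFrame.coord_apply (he : IsSimplicialFrame S e) (i j : Fin d) :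
    he.coord i (e j) = if j = i then 1 else 0 := by
  change he.exists_dual.choose (toRat (e j)) i = _
  rw [he.exists_dual.choose_spec j, Finsupp.single_apply]

theorem IsCoords.eq_coord (he : IsSimplicialFrame S e) {x : Fin n → ℤ} {c : Fin d → ℚ}
    (h : IsCoords e x c) : c = fun i => he.coord i x := by
  funext i
  change _ = he.exists_dual.choose (toRat x) i
  rw [show toRat x = _ from h]
  simp only [map_sum, map_smul, he.exists_dual.choose_spec]
  simp [Finsupp.finsetSum_apply, Finsupp.single_apply]

theorem IsSimplicialFrame.isCoords (he : IsSimplicialFrame S e) {x : Fin n → ℤ} (hx : x ∈ S) :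
    IsCoords e x fun i => he.coord i x := by
  obtain ⟨c, hc, -⟩ := exists_coords he hx
  rwa [← hc.eq_coord he]

theorem IsSimplicialFrame.coord_nonneg (he : IsSimplicialFrame S e) {x : Fin n → ℤ} (hx : x ∈ S)
    (i : Fin d) : 0 ≤ he.coord i x := by
  obtain ⟨c, hc, h0⟩ := exists_coords he hx
  rw [hc.eq_coord he] at h0
  exact h0 i

theorem IsSimplicialFrame.coord_sum (he : IsSimplicialFrame S e) (z : Fin d → ℤ) (i : Fin d) :
    he.coord i (∑ j, z j • e j) = z i := by
  simp only [map_sum, map_zsmul, he.coord_apply]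
  simp

theorem IsSimplicialFrame.eq_zero_of_coord_eq_zero (he : IsSimplicialFrame S e) {x : Fin n → ℤ}
    (hx : x ∈ S) (h : ∀ i, he.coord i x = 0) : x = 0 := by
  apply toRat_injective
  rw [show toRat x = _ from he.isCoords hx]
  simp only [h, zero_smul, Finset.sum_const_zero]
  ext; simp [toRat]

/-- Every element of `S` has a positive multiple in the monoid generated by the frame. -/
theorem IsSimplicialFrame.exists_nsmul_eq_sum (he : IsSimplicialFrame S e) {x : Fin n → ℤ}
    (hx : x ∈ S) : ∃ k : ℕ, 0 < k ∧ ∃ a : Fin d → ℕ, (∀ i, (a i : ℚ) = k * he.coord i x) ∧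
      k • x = ∑ i, a i • e i := by
  -- The product of all denominators serves as a common denominator.
  have hk (i : Fin d) : ∃ a : ℕ, (a : ℚ) = ((∏ j, (he.coord j x).den : ℕ) : ℚ) * he.coord i x := by
    have h0 := he.coord_nonneg hx i
    refine ⟨(∏ j ∈ Finset.univ.erase i, (he.coord j x).den) * (he.coord i x).num.toNat, ?_⟩
    rw [← Finset.prod_erase_mul _ _ (Finset.mem_univ i)]
    push_cast
    rw [mul_assoc, Rat.den_mul_eq_num]
    congr 1
    exact_mod_cast Int.toNat_of_nonneg (Rat.num_nonneg.2 h0)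
  choose a ha using hk
  refine ⟨_, Finset.prod_pos fun j _ => (he.coord j x).den_pos, a, ha, toRat_injective ?_⟩
  have h1 : toRat (∑ i, a i • e i) = ∑ i, (a i : ℚ) • toRat (e i) := by
    simpa using toRat_sum_smul (fun i => (a i : ℤ)) e
  have h2 (k : ℕ) : toRat (k • x) = (k : ℚ) • toRat x := by
    ext; simp [toRat]
  rw [h1, h2, show toRat x = _ from he.isCoords hx, Finset.smul_sum]
  exact Finset.sum_congr rfl fun i _ => by rw [ha, smul_smul]

theorem IsSimplicialFrame.exists_nsmul_eq_add (he : IsSimplicialFrame S e) {x : Fin n → ℤ}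
    (hx : x ∈ S) (hx0 : x ≠ 0) : ∃ k : ℕ, ∃ l, ∃ c ∈ S, k • x = e l + c := by
  obtain ⟨k, hk, a, ha, h⟩ := he.exists_nsmul_eq_sum hx
  obtain ⟨l, hl⟩ : ∃ l, a l ≠ 0 := by
    by_contra! h0
    refine hx0 (he.eq_zero_of_coord_eq_zero hx fun i => ?_)
    have := ha i
    rw [h0 i] at this
    have hk' : (k : ℚ) ≠ 0 := by positivity
    simpa [hk'] using this.symm
  obtain ⟨b, hb⟩ := Nat.exists_eq_succ_of_ne_zero hl
  refine ⟨k, l, b • e l + ∑ i ∈ Finset.univ.erase l, a i • e i,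
    add_mem (nsmul_mem (he.mem l) _) (sum_mem fun i _ => nsmul_mem (he.mem i) _), ?_⟩
  rw [h, ← Finset.add_sum_erase _ _ (Finset.mem_univ l), hb, Nat.succ_eq_add_one, add_smul, one_smul]
  abel

instance uniqueSums_addSubmonoid : UniqueSums S :=
  UniqueSums.of_injective_addHom (S.subtype : S →ₙ+ (Fin n → ℤ)) Subtype.val_injective inferInstance

variable (K : Type*) [Field K]

instance isDomain_addMonoidAlgebra : IsDomain (AddMonoidAlgebra K S) :=
  NoZeroDivisors.to_isDomain _

open Classical in
/-- The projection of the semigroup ring onto the face where the coordinates in `J` vanish. -/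
noncomputable def IsSimplicialFrame.faceHom (he : IsSimplicialFrame S e) (J : Finset (Fin d)) :
    AddMonoidAlgebra K S →ₐ[K] AddMonoidAlgebra K S :=
  AddMonoidAlgebra.lift K _ S
    { toFun := fun b => if ∀ i ∈ J, he.coord i b.toAdd = 0 then .single b.toAdd 1 else 0
      map_one' := by simp [AddMonoidAlgebra.one_def]
      map_mul' := fun a b => by
        -- Coordinates are nonnegative on `S`, so a sum lies on the face exactly when both summands
        -- do.
        have h : (∀ i ∈ J, he.coord i ((a * b).toAdd : S) = 0) ↔
            (∀ i ∈ J, he.coord i (a.toAdd : S) = 0) ∧ ∀ i ∈ J, he.coord i (b.toAdd : S) = 0 := by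
          rw [← forall₂_and]
          refine forall₂_congr fun i _ => ?_
          rw [toAdd_mul, AddSubmonoid.coe_add, map_add, add_eq_zero_iff_of_nonneg
            (he.coord_nonneg a.toAdd.2 i) (he.coord_nonneg b.toAdd.2 i)]
        simp only [h]
        split_ifs with h1 h2 h3 h4 h5 <;> try tauto
        · simp [AddMonoidAlgebra.single_mul_single]
        · simp }

open Classical in
theorem IsSimplicialFrame.coeff_faceHom (he : IsSimplicialFrame S e) (J : Finset (Fin d))
    (f : AddMonoidAlgebra K S) (b : S) : (he.faceHom K J f).coeff b =
      if ∀ i ∈ J, he.coord i b = 0 then f.coeff b else 0 := by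
  induction f using AddMonoidAlgebra.induction_linear with
  | zero => simp
  | add f g hf hg =>
    rw [map_add, AddMonoidAlgebra.coeff_add, Finsupp.add_apply, hf, hg]
    split_ifs <;> simp
  | single a c =>
    rw [faceHom, AddMonoidAlgebra.lift_single]
    by_cases hab : a = b
    · subst hab
      simp only [MonoidHom.coe_mk, OneHom.coe_mk, toAdd_ofAdd]
      split_ifs <;> simp
    · simp only [MonoidHom.coe_mk, OneHom.coe_mk, toAdd_ofAdd]
      split_ifs <;> simp [hab]

/-- The prime ideal of a face. -/
noncomputable def IsSimplicialFrame.facePrime (he : IsSimplicialFrame S e) (J : Finset (Fin d)) :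
    Ideal (AddMonoidAlgebra K S) := RingHom.ker (he.faceHom K J)

instance IsSimplicialFrame.facePrime_isPrime (he : IsSimplicialFrame S e) (J : Finset (Fin d)) :
    (he.facePrime K J).IsPrime := RingHom.ker_isPrime _

theorem IsSimplicialFrame.mem_facePrime (he : IsSimplicialFrame S e) {J : Finset (Fin d)}
    {f : AddMonoidAlgebra K S} : f ∈ he.facePrime K J ↔
      ∀ b : S, (∀ i ∈ J, he.coord i b = 0) → f.coeff b = 0 := by
  rw [facePrime, RingHom.mem_ker, ← AddMonoidAlgebra.coeff_inj, Finsupp.ext_iff]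
  refine forall_congr' fun b => ?_
  change (he.faceHom K J f).coeff b = 0 ↔ _
  rw [coeff_faceHom]
  split_ifs with h
  · exact ⟨fun h' _ => h', fun h' => h' h⟩
  · exact ⟨fun _ h' => absurd h' h, fun _ => rfl⟩

/-- The face where all coordinates vanish is the origin, so this prime is the irrelevant ideal. -/
theorem IsSimplicialFrame.mem_facePrime_univ (he : IsSimplicialFrame S e)
    {f : AddMonoidAlgebra K S} : f ∈ he.facePrime K Finset.univ ↔ f.coeff 0 = 0 := by
  rw [mem_facePrime]
  refine ⟨fun h => h 0 (by simp), fun h b hb => ?_⟩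
  rwa [show b = 0 from Subtype.ext (he.eq_zero_of_coord_eq_zero b.2 fun i => hb i (by simp))]

instance IsSimplicialFrame.facePrime_univ_isMaximal (he : IsSimplicialFrame S e) :
    (he.facePrime K Finset.univ).IsMaximal := by
  rw [Ideal.isMaximal_iff]
  refine ⟨(Ideal.ne_top_iff_one _).1 (he.facePrime_isPrime K _).ne_top, fun J f hJ hf hfJ => ?_⟩
  rw [mem_facePrime_univ] at hf
  have h1 : f - algebraMap K _ (f.coeff 0) ∈ J := hJ (by
    rw [mem_facePrime_univ]; simp [AddMonoidAlgebra.coe_algebraMap])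
  have h2 : algebraMap K (AddMonoidAlgebra K S) (f.coeff 0) ∈ J := by
    simpa using J.sub_mem hfJ h1
  have h3 := J.mul_mem_left (algebraMap K _ (f.coeff 0)⁻¹) h2
  rwa [← map_mul, inv_mul_cancel₀ hf, map_one] at h3

/-- Adding an index `i` to `J` strictly enlarges the face prime, since `t^(e i)` enters it; this
builds a chain of primes. -/
theorem IsSimplicialFrame.card_le_height_facePrime (he : IsSimplicialFrame S e)
    (J : Finset (Fin d)) : (J.card : ℕ∞) ≤ (he.facePrime K J).height := by
  classical
  induction J using Finset.induction_on with
  | empty => simp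
  | insert i J hi ih =>
    rw [Finset.card_insert_of_notMem hi]
    push_cast
    refine (add_le_add_left ih 1).trans (Ideal.height_add_one_le_of_lt_of_isPrime ?_)
    refine lt_of_le_of_ne (fun f hf => ?_) fun h => ?_
    · rw [mem_facePrime] at hf ⊢
      exact fun b hb => hf b fun l hl => hb l (Finset.mem_insert_of_mem hl)
    · have h1 : (.single ⟨e i, he.mem i⟩ 1 : AddMonoidAlgebra K S) ∈ he.facePrime K J := by
        rw [h, mem_facePrime]
        intro b hb
        rw [AddMonoidAlgebra.coeff_single, Finsupp.single_apply, if_neg]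
        rintro rfl
        simpa [he.coord_apply] using hb i (Finset.mem_insert_self _ _)
      rw [mem_facePrime] at h1
      have := h1 ⟨e i, he.mem i⟩ fun l hl => by
        rw [he.coord_apply, if_neg]
        rintro rfl
        exact hi hl
      simp at this

theorem IsSimplicialFrame.single_mem_facePrime_univ (he : IsSimplicialFrame S e) (i : Fin d) :
    .single ⟨e i, he.mem i⟩ 1 ∈ he.facePrime K Finset.univ := by
  rw [mem_facePrime_univ, AddMonoidAlgebra.coeff_single, Finsupp.single_apply, if_neg]
  intro h
  have := congrArg (fun b : S => he.coord i b) h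
  simp [he.coord_apply] at this

/-- Some power of each monomial other than `1` is divisible by a frame monomial, so the irrelevant
ideal lies in the radical of the ideal of the frame monomials. -/
theorem IsSimplicialFrame.facePrime_univ_le (he : IsSimplicialFrame S e)
    {Q : Ideal (AddMonoidAlgebra K S)} [hQ : Q.IsPrime]
    (h : ∀ i, .single ⟨e i, he.mem i⟩ 1 ∈ Q) : he.facePrime K Finset.univ ≤ Q := by
  intro f hf
  rw [mem_facePrime_univ] at hf
  rw [← AddMonoidAlgebra.sum_coeff_single f]
  refine Q.sum_mem fun b hb => ?_
  have hb0 : (b : Fin n → ℤ) ≠ 0 := by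
    intro h0
    rw [Finsupp.mem_support_iff] at hb
    exact hb (by rwa [show b = 0 from Subtype.ext h0])
  obtain ⟨k, l, c, hc, hk⟩ := he.exists_nsmul_eq_add b.2 hb0
  have hmem : (.single b 1 : AddMonoidAlgebra K S) ∈ Q := by
    refine hQ.mem_of_pow_mem k ?_
    rw [AddMonoidAlgebra.single_pow, one_pow,
      show k • b = ⟨e l, he.mem l⟩ + ⟨c, hc⟩ from Subtype.ext hk, ← mul_one (1 : K),
      ← AddMonoidAlgebra.single_mul_single]
    exact Q.mul_mem_right _ (h l)
  have := Q.mul_mem_left (algebraMap K _ (f.coeff b)) hmem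
  simpa [AddMonoidAlgebra.coe_algebraMap, AddMonoidAlgebra.single_mul_single] using this

end SimplicialSemigroup

/-! ### Frame monomials in a Cohen-Macaulay semigroup ring -/

section

open IsLocalRing

namespace SimplicialSemigroup

variable {n d : ℕ} {S : AddSubmonoid (Fin n → ℤ)} {e : Fin d → Fin n → ℤ}
variable (K : Type*) [Field K]

/-- In a Noetherian semigroup ring localized at the irrelevant ideal, a prime ideal that contains
two of the frame elements has coheight at most `d - 2`. -/
theorem IsSimplicialFrame.ringKrullDim_quotient_le (he : IsSimplicialFrame S e)
    [IsNoetherianRing (AddMonoidAlgebra K S)] {i j : Fin d} (hij : i ≠ j)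
    (L : Type*) [CommRing L] [IsLocalRing L] [Algebra (AddMonoidAlgebra K S) L]
    [IsLocalization.AtPrime L (he.facePrime K Finset.univ)] (P : Ideal L) [hP : P.IsPrime]
    (hi : algebraMap _ _ (.single ⟨e i, he.mem i⟩ 1 : AddMonoidAlgebra K S) ∈ P)
    (hj : algebraMap _ _ (.single ⟨e j, he.mem j⟩ 1 : AddMonoidAlgebra K S) ∈ P) :
    ringKrullDim (L ⧸ P) ≤ (d - 2 : ℕ) := by
  classical
  set m := he.facePrime K Finset.univ with hm
  have : IsLocalRing (L ⧸ P) :=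
    IsLocalRing.of_surjective' (Ideal.Quotient.mk P) Ideal.Quotient.mk_surjective
  have : IsNoetherianRing L := IsLocalization.isNoetherianRing m.primeCompl L inferInstance
  let φ : AddMonoidAlgebra K S →+* L ⧸ P := (Ideal.Quotient.mk P).comp (algebraMap _ L)
  let s : Finset (L ⧸ P) := ((Finset.univ.erase i).erase j).image
    fun l => φ (.single ⟨e l, he.mem l⟩ 1)
  have hs : s.card ≤ d - 2 := by
    refine Finset.card_image_le.trans ?_
    rw [Finset.card_erase_of_mem (by simp [hij.symm]), Finset.card_erase_of_mem (by simp)]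
    simp [Nat.sub_sub]
  -- A prime over `s` contains the images of all frame monomials, those of `i` and `j` being zero,
  -- hence the image of the irrelevant ideal. Krull's height theorem then bounds the dimension by
  -- the size of `s`.
  have hmin : maximalIdeal (L ⧸ P) ∈ (Ideal.span (s : Set (L ⧸ P))).minimalPrimes := by
    refine ⟨⟨inferInstance, ?_⟩, ?_⟩
    · rw [Ideal.span_le]
      intro a ha
      obtain ⟨l, -, rfl⟩ := Finset.mem_image.1 (Finset.mem_coe.1 ha)
      refine fun hunit => ?_
      have := IsLocalHom.of_surjective (Ideal.Quotient.mk P) Ideal.Quotient.mk_surjective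
      exact (IsLocalization.AtPrime.to_map_mem_maximal_iff L m _).2
        (he.single_mem_facePrime_univ K l) (isUnit_of_map_unit (Ideal.Quotient.mk P) _ hunit)
    · rintro Q ⟨hQ, hsQ⟩ -
      have hmQ : m ≤ Q.comap φ := by
        have : (Q.comap φ).IsPrime := Ideal.comap_isPrime φ Q
        refine he.facePrime_univ_le K fun l => ?_
        rw [Ideal.mem_comap]
        by_cases hli : l = i
        · subst hli
          rw [RingHom.comp_apply, Ideal.Quotient.eq_zero_iff_mem.2 hi]
          exact Q.zero_mem
        by_cases hlj : l = j
        · subst hlj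
          rw [RingHom.comp_apply, Ideal.Quotient.eq_zero_iff_mem.2 hj]
          exact Q.zero_mem
        exact hsQ (Ideal.subset_span (Finset.mem_coe.2 (Finset.mem_image_of_mem _ (by simp [hli, hlj]))))
      intro a ha
      obtain ⟨a, rfl⟩ := Ideal.Quotient.mk_surjective a
      have ha' : a ∈ maximalIdeal L := by
        rw [mem_maximalIdeal, mem_nonunits_iff] at ha ⊢
        exact fun h => ha (h.map _)
      rw [← IsLocalization.AtPrime.map_eq_maximalIdeal m L] at ha'
      have : Ideal.map (algebraMap (AddMonoidAlgebra K S) L) m ≤ Q.comap (Ideal.Quotient.mk P) := by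
        rw [Ideal.map_le_iff_le_comap, Ideal.comap_comap]
        exact hmQ
      exact this ha'
  rw [← IsLocalRing.maximalIdeal_height_eq_ringKrullDim]
  have := (Ideal.height_le_card_of_mem_minimalPrimes_span_finset hmin).trans (by exact_mod_cast hs :
    (s.card : ℕ∞) ≤ ((d - 2 : ℕ) : ℕ∞))
  exact WithBot.coe_le_coe.2 this

/-- If the semigroup ring of `S` is Cohen-Macaulay, then any two elements of the frame form a
regular sequence. -/
theorem IsSimplicialFrame.mem_of_add_mem (he : IsSimplicialFrame S e)
    (hCM : IsCohenMacaulayRing (AddMonoidAlgebra K S)) {i j : Fin d} (hij : i ≠ j)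
    {x : Fin n → ℤ} (hi : x + e i ∈ S) (hj : x + e j ∈ S) : x ∈ S := by
  by_contra hx
  have hN := hCM.isNoetherianRing
  set m := he.facePrime K Finset.univ with hm
  let L := Localization.AtPrime m
  have hNL : IsNoetherianRing L := IsLocalization.isNoetherianRing m.primeCompl L inferInstance
  let t (b : S) : L := algebraMap (AddMonoidAlgebra K S) L (.single b 1)
  have hinj : Function.Injective (algebraMap (AddMonoidAlgebra K S) L) :=
    IsLocalization.injective L m.primeCompl_le_nonZeroDivisors
  have ht0 (b : S) : t b ≠ 0 := by
    rw [ne_eq, map_eq_zero_iff _ hinj, AddMonoidAlgebra.single_eq_zero]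
    exact one_ne_zero
  have : IsDomain L := IsLocalization.isDomain_localization m.primeCompl_le_nonZeroDivisors
  have hti : t ⟨e i, he.mem i⟩ ∈ maximalIdeal L := by
    exact (IsLocalization.AtPrime.to_map_mem_maximal_iff L m _).2
      (he.single_mem_facePrime_univ K i)
  -- `t^(e j) t^(x + e i) = t^(e i) t^(x + e j)`.
  have hyu : t ⟨e j, he.mem j⟩ * t ⟨_, hi⟩ ∈ Ideal.span {t ⟨e i, he.mem i⟩} := by
    rw [Ideal.mem_span_singleton]
    refine ⟨t ⟨_, hj⟩, ?_⟩
    simp only [t, ← map_mul, AddMonoidAlgebra.single_mul_single]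
    congr 2
    ext1
    simp only [AddSubmonoid.coe_add]
    abel
  have hu : t ⟨_, hi⟩ ∉ Ideal.span {t ⟨e i, he.mem i⟩} := by
    rw [Ideal.mem_span_singleton]
    rintro ⟨w, hw⟩
    obtain ⟨⟨g, s⟩, hgs⟩ := IsLocalization.surj m.primeCompl w
    -- Compare coefficients at `x + e i`: the left one is the constant term of `s`, nonzero because
    -- `s` lies outside `m`; the right one vanishes because `x` is not in `S`.
    have h1 : (s : AddMonoidAlgebra K S) * .single ⟨_, hi⟩ 1 = .single ⟨e i, he.mem i⟩ 1 * g := by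
      apply hinj
      rw [map_mul, map_mul, ← hgs]
      change _ * t _ = t _ * (w * _)
      rw [hw]
      ring
    have h2 := congrArg (fun f : AddMonoidAlgebra K S => f.coeff ⟨_, hi⟩) h1
    rw [AddMonoidAlgebra.coeff_mul_single_eq_coeff_mul 0 (fun b _ => by
        rw [Subtype.ext_iff, Subtype.ext_iff]; simp),
      AddMonoidAlgebra.coeff_single_mul_of_forall_add_ne _ _ fun c hc => ?_, mul_one] at h2
    · exact s.2 ((he.mem_facePrime_univ K).2 h2)
    · refine hx ?_
      have := congrArg Subtype.val hc
      simp only [AddSubmonoid.coe_add] at this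
      rw [add_comm x, add_right_inj] at this
      exact this ▸ c.2
  have hd : 2 ≤ d := by
    have := i.2
    have := j.2
    by_contra! h
    exact hij (Fin.ext (by omega))
  obtain ⟨k, rfl⟩ := Nat.exists_eq_add_of_le hd
  -- With `d = 2 + k`, depth at least `d` yields a prime of coheight at least `1 + k`, while
  -- containing both monomials forces coheight at most `k`.
  have hdim : (((1 + k + 1 : ℕ) : ℕ∞) : WithBot ℕ∞) ≤ localDepth L := by
    rw [hCM.depth_eq_dim m, IsLocalization.AtPrime.ringKrullDim_eq_height m, WithBot.coe_le_coe]
    have := he.card_le_height_facePrime K Finset.univ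
    rw [Finset.card_fin] at this
    rwa [show 1 + k + 1 = 2 + k by omega]
  rw [WithBot.coe_le_coe] at hdim
  obtain ⟨P, hP, hPi, hPj, hle⟩ := exists_isPrime_localDepth_le hti
    (IsSMulRegular.of_ne_zero (ht0 _)) hyu hu hdim
  have := hle.trans (he.ringKrullDim_quotient_le K hij L P hPi hPj)
  norm_cast at this
  omega

end SimplicialSemigroup

end

/-! ### A freeness criterion for semigroup rings -/

/-- A semigroup ring is finite and free over the polynomial ring generated by elements `ε i` of the
monoid if every element of the monoid is uniquely the sum of an element of a finite set and a
combination of the `ε i`. -/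
theorem AddMonoidAlgebra.isCohenMacaulayRing_of_bijective (K : Type*) [Field K] {T : Type*}
    [AddCommMonoid T] {d : ℕ} (ε : Fin d → T) {H : Set T} (hfin : H.Finite)
    (hbij : Function.Bijective fun q : H × (Fin d →₀ ℕ) => (q.1 : T) + ∑ i, q.2 i • ε i) :
    IsCohenMacaulayRing (AddMonoidAlgebra K T) := by
  classical
  let φ : MvPolynomial (Fin d) K →ₐ[K] AddMonoidAlgebra K T :=
    MvPolynomial.aeval fun i => .single (ε i) 1
  let : Algebra (MvPolynomial (Fin d) K) (AddMonoidAlgebra K T) := φ.toAlgebra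
  let ψ : (H →₀ MvPolynomial (Fin d) K) →ₗ[MvPolynomial (Fin d) K] AddMonoidAlgebra K T :=
    Finsupp.linearCombination _ fun h : H => (.single (h : T) 1 : AddMonoidAlgebra K T)
  have hφ (a : Fin d →₀ ℕ) (c : K) :
      φ (MvPolynomial.monomial a c) = .single (∑ i, a i • ε i) c := by
    rw [MvPolynomial.aeval_monomial, AddMonoidAlgebra.coe_algebraMap,
      Finsupp.prod_fintype _ _ (by simp)]
    simp [AddMonoidAlgebra.single_pow, AddMonoidAlgebra.prod_single,
      AddMonoidAlgebra.single_mul_single]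
  have hψ (h : H) (a : Fin d →₀ ℕ) (c : K) : ψ (Finsupp.single h (MvPolynomial.monomial a c)) =
      .single (h + ∑ i, a i • ε i) c := by
    simp only [ψ, Finsupp.linearCombination_single]
    rw [Algebra.smul_def]
    change φ _ * _ = _
    rw [hφ, AddMonoidAlgebra.single_mul_single, mul_one, add_comm]
  -- Uniqueness of the decomposition prevents distinct terms from merging, so `ψ` merely relabels
  -- coefficients.
  have hcoeff (f : H →₀ MvPolynomial (Fin d) K) (h : H) (a : Fin d →₀ ℕ) :
      (ψ f).coeff (h + ∑ i, a i • ε i) = (f h).coeff a := by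
    induction f using Finsupp.induction_linear with
    | zero => simp
    | add f g hf hg => simp [hf, hg]
    | single h' p =>
      induction p using AddMonoidAlgebra.induction_linear with
      | zero => simp
      | add p q hp hq =>
        rw [Finsupp.single_add, map_add ψ, AddMonoidAlgebra.coeff_add, Finsupp.add_apply, hp, hq,
          Finsupp.add_apply, MvPolynomial.coeff_add]
      | single b c =>
        have hinj := hbij.1.eq_iff (a := (h', b)) (b := (h, a))
        rw [MvPolynomial.single_eq_monomial, hψ, AddMonoidAlgebra.coeff_single,
          Finsupp.single_apply, hinj, Prod.mk.injEq, Finsupp.single_apply]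
        by_cases h1 : h' = h <;> simp [h1, MvPolynomial.coeff_monomial]
  have hψb : Function.Bijective ψ := by
    constructor
    · rw [injective_iff_map_eq_zero]
      intro f hf
      ext h a
      have := hcoeff f h a
      rw [hf] at this
      simpa using this.symm
    · intro x
      induction x using AddMonoidAlgebra.induction_linear with
      | zero => exact ⟨0, map_zero _⟩
      | add x y hx hy =>
        obtain ⟨f, rfl⟩ := hx
        obtain ⟨g, rfl⟩ := hy
        exact ⟨f + g, map_add _ _ _⟩
      | single t c =>
        obtain ⟨⟨h, a⟩, rfl⟩ := hbij.2 t
        exact ⟨_, hψ h a c⟩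
  have := hfin.to_subtype
  have := Module.Free.of_equiv (LinearEquiv.ofBijective ψ hψb)
  have := Module.Finite.equiv (LinearEquiv.ofBijective ψ hψb)
  exact IsCohenMacaulayRing.of_free_mvPolynomial K d _

/-! ### Apéry classes, shifts and the structure of the extension -/

namespace SimplicialSemigroup

variable {n d : ℕ} {B : AddSubmonoid (Fin n → ℤ)} {e : Fin d → Fin n → ℤ}

theorem mem_freePart {a : Fin n → ℤ} : a ∈ freePart e ↔ ∃ p : Fin d → ℕ, ∑ i, p i • e i = a := by
  rw [← Submodule.mem_span_range_iff_exists_fun ℕ, ← Submodule.mem_toAddSubmonoid,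
    Submodule.span_nat_eq_addSubmonoidClosure]
  rfl

theorem equivalent_add_sum (x : Fin n → ℤ) (z : Fin d → ℤ) :
    Equivalent e (x + ∑ i, z i • e i) x := by
  unfold Equivalent
  rw [add_sub_cancel_left]
  exact sum_mem fun i _ => zsmul_mem (AddSubgroup.subset_closure
    (AddSubmonoid.subset_closure (Set.mem_range_self i))) _

theorem Equivalent.symm {x y : Fin n → ℤ} (h : Equivalent e x y) : Equivalent e y x := by
  unfold Equivalent at *
  rw [← neg_sub]
  exact neg_mem h

theorem Equivalent.trans {x y z : Fin n → ℤ} (h : Equivalent e x y) (h' : Equivalent e y z) :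
    Equivalent e x z := by
  unfold Equivalent at *
  rw [← sub_add_sub_cancel x y z]
  exact add_mem h h'

theorem self_mem_aperyClass {y : Fin n → ℤ} (hy : y ∈ apery B e) : y ∈ aperyClass B e y :=
  ⟨hy, by unfold Equivalent; rw [sub_self]; exact zero_mem _⟩

theorem aperyClass_congr {x y : Fin n → ℤ} (h : Equivalent e x y) :
    aperyClass B e x = aperyClass B e y := by
  ext u
  exact and_congr_right fun _ => ⟨fun h' => h'.trans h, fun h' => h'.trans h.symm⟩

theorem IsSimplicialFrame.coord_sum_nat (he : IsSimplicialFrame B e) (p : Fin d → ℕ) (i : Fin d) :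
    he.coord i (∑ j, p j • e j) = p i := by
  simpa using he.coord_sum (fun j => (p j : ℤ)) i

theorem IsCoords.add_sum {x : Fin n → ℤ} {c : Fin d → ℚ} (h : IsCoords e x c) (z : Fin d → ℤ) :
    IsCoords e (x + ∑ i, z i • e i) fun i => c i + z i := by
  unfold IsCoords at h ⊢
  rw [toRat_add, toRat_sum_smul, h]
  simp only [add_smul, Finset.sum_add_distrib]

theorem IsCoords.injective {x y : Fin n → ℤ} {c : Fin d → ℚ} (h : IsCoords e x c)
    (h' : IsCoords e y c) : x = y :=
  toRat_injective (h.trans h'.symm)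

theorem IsShift.isCoords (he : IsSimplicialFrame B e) {Γ : Set (Fin n → ℤ)} {h : Fin n → ℤ}
    (hh : IsShift e Γ h) : IsCoords e h fun i => he.coord i h := by
  obtain ⟨μ, hμ, -⟩ := hh
  rwa [← hμ.eq_coord he]

theorem IsShift.exists_coord_eq (he : IsSimplicialFrame B e) {Γ : Set (Fin n → ℤ)}
    {h : Fin n → ℤ} (hh : IsShift e Γ h) (i : Fin d) : ∃ x ∈ Γ, he.coord i x = he.coord i h := by
  obtain ⟨μ, hμ, hl⟩ := hh
  obtain ⟨x, hx, c, hc, hci⟩ := (hl i).1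
  rw [hμ.eq_coord he, hc.eq_coord he] at hci
  exact ⟨x, hx, hci⟩

theorem IsShift.coord_le (he : IsSimplicialFrame B e) {y h : Fin n → ℤ}
    (hh : IsShift e (aperyClass B e y) h) (i : Fin d) {x : Fin n → ℤ}
    (hx : x ∈ aperyClass B e y) : he.coord i h ≤ he.coord i x := by
  obtain ⟨μ, hμ, hl⟩ := hh
  have := (hl i).2 ⟨x, hx, _, he.isCoords hx.1.1, rfl⟩
  rwa [hμ.eq_coord he] at this

/-- Each coordinate of `h` is that of some member of the class, hence differs from that of `y` by an
integer. -/
theorem IsShift.exists_int (he : IsSimplicialFrame B e) {y h : Fin n → ℤ} (hy : y ∈ apery B e)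
    (hh : IsShift e (aperyClass B e y) h) : ∃ z : Fin d → ℤ, h = y + ∑ i, z i • e i := by
  have hz (i : Fin d) : ∃ z : ℤ, he.coord i h = he.coord i y + z := by
    obtain ⟨x, hx, hxi⟩ := hh.exists_coord_eq he i
    obtain ⟨z, rfl⟩ := hx.2.exists_int
    exact ⟨z i, by rw [← hxi, map_add, he.coord_sum]⟩
  choose z hz using hz
  refine ⟨z, (hh.isCoords he).injective ?_⟩
  simp only [hz]
  exact (he.isCoords hy.1).add_sum z

theorem IsShift.equivalent (he : IsSimplicialFrame B e) {y h : Fin n → ℤ} (hy : y ∈ apery B e)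
    (hh : IsShift e (aperyClass B e y) h) : Equivalent e h y := by
  obtain ⟨z, rfl⟩ := hh.exists_int he hy
  exact equivalent_add_sum y z

/-- Two equivalent elements whose coordinates are comparable differ by an element of the free
part. -/
theorem Equivalent.exists_nat (he : IsSimplicialFrame B e) {x h : Fin n → ℤ}
    (hxh : Equivalent e x h) (hle : ∀ i, he.coord i h ≤ he.coord i x) :
    ∃ p : Fin d → ℕ, x = h + ∑ i, p i • e i := by
  obtain ⟨z, rfl⟩ := hxh.exists_int
  refine ⟨fun i => (z i).toNat, ?_⟩
  congr 1
  refine Finset.sum_congr rfl fun i _ => ?_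
  have h0 : 0 ≤ z i := by
    have := hle i
    rw [map_add, he.coord_sum, le_add_iff_nonneg_right] at this
    exact_mod_cast this
  rw [← natCast_zsmul, Int.toNat_of_nonneg h0]

theorem IsShift.coord_nonneg (he : IsSimplicialFrame B e) {y h : Fin n → ℤ}
    (hh : IsShift e (aperyClass B e y) h) (i : Fin d) : 0 ≤ he.coord i h := by
  obtain ⟨x, hx, hxi⟩ := hh.exists_coord_eq he i
  exact hxi ▸ he.coord_nonneg hx.1.1 i

/-- Subtracting a nonzero element of `A` lowers the coordinate sum by at least `1`, and that sum is
nonnegative on `B`, so the process stops. -/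
theorem IsSimplicialFrame.exists_eq_apery_add (he : IsSimplicialFrame B e) {b : Fin n → ℤ}
    (hb : b ∈ B) : ∃ x ∈ apery B e, ∃ p : Fin d → ℕ, b = x + ∑ i, p i • e i := by
  obtain ⟨N, hN⟩ := exists_nat_gt (∑ i, he.coord i b)
  induction N generalizing b with
  | zero =>
    have := Finset.sum_nonneg fun i (_ : i ∈ Finset.univ) => he.coord_nonneg hb i
    push_cast at hN
    linarith
  | succ N ih =>
    by_cases hba : b ∈ apery B e
    · exact ⟨b, hba, 0, by simp⟩
    · have : ∃ a ∈ freePart e, a ≠ 0 ∧ b - a ∈ B := by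
        by_contra! h
        exact hba ⟨hb, h⟩
      obtain ⟨a, ha, ha0, hab⟩ := this
      obtain ⟨p, rfl⟩ := mem_freePart.1 ha
      have hp : 1 ≤ ∑ i, p i := by
        by_contra! h
        have h0 : ∀ i, p i = 0 := by simpa using Nat.lt_one_iff.1 h
        exact ha0 (by simp [h0])
      obtain ⟨x, hx, q, hq⟩ := ih hab (by
        simp only [map_sub, he.coord_sum_nat, Finset.sum_sub_distrib]
        have : (1 : ℚ) ≤ ∑ i, (p i : ℚ) := by exact_mod_cast hp
        push_cast at hN
        linarith)
      refine ⟨x, hx, q + p, ?_⟩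
      rw [sub_eq_iff_eq_add] at hq
      simp only [hq, Pi.add_apply, add_smul, Finset.sum_add_distrib, add_assoc]

/-- The minimum defining `h` runs over Apéry elements only; adding elements of `A` extends the bound
to all of `B` in the class. -/
theorem IsShift.exists_nat (he : IsSimplicialFrame B e) {y h : Fin n → ℤ} (hy : y ∈ apery B e)
    (hh : IsShift e (aperyClass B e y) h) {b : Fin n → ℤ} (hb : b ∈ B) (hby : Equivalent e b y) :
    ∃ p : Fin d → ℕ, b = h + ∑ i, p i • e i := by
  obtain ⟨x, hx, p, rfl⟩ := he.exists_eq_apery_add hb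
  have hxy : x ∈ aperyClass B e y := by
    refine ⟨hx, Equivalent.trans (Equivalent.symm ?_) hby⟩
    simpa using equivalent_add_sum (e := e) x fun i => (p i : ℤ)
  obtain ⟨q, rfl⟩ := (hxy.2.trans (hh.equivalent he hy).symm).exists_nat he
    fun i => hh.coord_le he i hxy
  exact ⟨q + p, by simp only [Pi.add_apply, add_smul, Finset.sum_add_distrib, add_assoc]⟩

theorem IsSimplicialFrame.zero_mem_apery (he : IsSimplicialFrame B e) : 0 ∈ apery B e := by
  refine ⟨zero_mem _, fun a ha ha0 h => ha0 ?_⟩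
  have haB : a ∈ B := by
    obtain ⟨p, rfl⟩ := mem_freePart.1 ha
    exact sum_mem fun i _ => nsmul_mem (he.mem i) _
  refine he.eq_zero_of_coord_eq_zero haB fun i => le_antisymm ?_ (he.coord_nonneg haB i)
  have := he.coord_nonneg h i
  rw [map_sub, map_zero] at this
  linarith

theorem IsSimplicialFrame.zero_mem_shifts (he : IsSimplicialFrame B e) : 0 ∈ shifts B e := by
  obtain ⟨h, hh, -⟩ := existsUnique_isShift he he.zero_mem_apery
  have h0 : h = 0 := by
    refine (hh.isCoords he).injective (y := 0) ?_
    have : (fun i => he.coord i h) = fun i => he.coord i 0 := by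
      funext i
      exact le_antisymm (hh.coord_le he i (self_mem_aperyClass he.zero_mem_apery))
        ((map_zero (he.coord i)).symm ▸ hh.coord_nonneg he i)
    rw [this]
    exact he.isCoords (zero_mem _)
  exact ⟨0, he.zero_mem_apery, h0 ▸ hh⟩

theorem IsSimplicialFrame.add_mem_shifts_add (he : IsSimplicialFrame B e) {h h' : Fin n → ℤ}
    (hh : h ∈ shifts B e) (hh' : h' ∈ shifts B e) :
    ∃ k ∈ shifts B e, ∃ p : Fin d → ℕ, h + h' = k + ∑ i, p i • e i := by
  obtain ⟨y, hy, hh⟩ := hh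
  obtain ⟨y', hy', hh'⟩ := hh'
  obtain ⟨x, hx, p, hp⟩ := he.exists_eq_apery_add (add_mem hy.1 hy'.1)
  obtain ⟨k, hk, -⟩ := existsUnique_isShift he hx
  have hadd {a b : Fin n → ℤ} (ha : Equivalent e a y) (hb : Equivalent e b y') :
      Equivalent e (a + b) x := by
    refine Equivalent.trans (y := y + y') ?_ ?_
    · unfold Equivalent at *
      rw [add_sub_add_comm]
      exact add_mem ha hb
    · rw [hp]
      simpa using equivalent_add_sum (e := e) x fun i => (p i : ℤ)
  refine ⟨k, ⟨x, hx, hk⟩, ((hadd (hh.equivalent he hy) (hh'.equivalent he hy')).trans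
    (hk.equivalent he hx).symm).exists_nat he fun i => ?_⟩
  -- The elements attaining the two minima may depend on `i`; only their `i`-th coordinates are
  -- compared with that of `k`.
  obtain ⟨u, hu, hui⟩ := hh.exists_coord_eq he i
  obtain ⟨u', hu', hui'⟩ := hh'.exists_coord_eq he i
  obtain ⟨q, hq⟩ := hk.exists_nat he hx (add_mem hu.1.1 hu'.1.1) (hadd hu.2 hu'.2)
  rw [map_add, ← hui, ← hui', ← map_add, hq, map_add, he.coord_sum_nat]
  simp

/-- The extension is the union of the translates of the free part by the shifts. -/
theorem IsSimplicialFrame.mem_tilde (he : IsSimplicialFrame B e) {x : Fin n → ℤ} :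
    x ∈ tilde B e ↔ ∃ h ∈ shifts B e, ∃ p : Fin d → ℕ, x = h + ∑ i, p i • e i := by
  classical
  constructor
  · intro hx
    induction hx using AddSubmonoid.closure_induction with
    | mem x hx =>
      rcases hx with ⟨i, rfl⟩ | hx
      · exact ⟨0, he.zero_mem_shifts, Pi.single i 1, by
          simp [Pi.single_apply, ite_smul]⟩
      · exact ⟨x, hx, 0, by simp⟩
    | zero => exact ⟨0, he.zero_mem_shifts, 0, by simp⟩
    | add x y _ _ hx hy =>
      obtain ⟨h, hh, p, rfl⟩ := hx
      obtain ⟨h', hh', p', rfl⟩ := hy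
      obtain ⟨k, hk, q, hq⟩ := he.add_mem_shifts_add hh hh'
      refine ⟨k, hk, q + (p + p'), ?_⟩
      rw [add_add_add_comm, hq]
      simp only [Pi.add_apply, add_smul, Finset.sum_add_distrib, add_assoc]
  · rintro ⟨h, hh, p, rfl⟩
    have hhT : h ∈ tilde B e := AddSubmonoid.subset_closure (Or.inr hh)
    have heT (i : Fin d) : e i ∈ tilde B e :=
      AddSubmonoid.subset_closure (Or.inl (Set.mem_range_self i))
    exact add_mem hhT (sum_mem fun i _ => nsmul_mem (heT i) _)

/-- A common element forces both shifts into one class, which has a single shift; the coordinates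
then determine `p`. -/
theorem IsSimplicialFrame.shifts_add_injective (he : IsSimplicialFrame B e) {h h' : Fin n → ℤ}
    (hh : h ∈ shifts B e) (hh' : h' ∈ shifts B e) {p p' : Fin d → ℕ}
    (heq : h + ∑ i, p i • e i = h' + ∑ i, p' i • e i) : h = h' ∧ p = p' := by
  obtain ⟨y, hy, hh⟩ := hh
  obtain ⟨y', hy', hh'⟩ := hh'
  have h1 : Equivalent e (h + ∑ i, p i • e i) h := by
    simpa using equivalent_add_sum (e := e) h fun i => (p i : ℤ)
  have h2 : Equivalent e (h + ∑ i, p i • e i) h' := by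
    rw [heq]
    simpa using equivalent_add_sum (e := e) h' fun i => (p' i : ℤ)
  have hyy' : Equivalent e y y' := (hh.equivalent he hy).symm.trans
    (h1.symm.trans (h2.trans (hh'.equivalent he hy')))
  rw [aperyClass_congr hyy'] at hh
  obtain rfl := (existsUnique_isShift he hy').unique hh hh'
  refine ⟨rfl, funext fun i => ?_⟩
  have := congrArg (he.coord i) (add_left_cancel heq : ∑ i, p i • e i = ∑ i, p' i • e i)
  rw [he.coord_sum_nat, he.coord_sum_nat] at this
  exact_mod_cast this

/-- Each generator `g` has a positive multiple `k g • g` in `A`, so in an Apéry element no nonzero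
generator can have a coefficient above `k g`. -/
theorem IsSimplicialFrame.finite_apery (he : IsSimplicialFrame B e) (hB : B.FG) :
    (apery B e).Finite := by
  classical
  obtain ⟨G, hG⟩ := hB
  have hGB (g : G) : (g : Fin n → ℤ) ∈ B := hG ▸ AddSubmonoid.subset_closure g.2
  choose k hk0 a ha hk using fun g : G => he.exists_nsmul_eq_sum (hGB g)
  refine ((Set.finite_Iic k).image fun c : G → ℕ => ∑ g, c g • (g : Fin n → ℤ)).subset ?_
  intro b hb
  have hbG : b ∈ Submodule.span ℕ (Set.range ((↑) : G → Fin n → ℤ)) := by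
    rw [← Submodule.mem_toAddSubmonoid, Submodule.span_nat_eq_addSubmonoidClosure]
    simpa [hG] using hb.1
  obtain ⟨c, rfl⟩ := (Submodule.mem_span_range_iff_exists_fun ℕ).1 hbG
  -- A zero generator could carry any coefficient, so its coefficient is reset to `0`.
  refine ⟨fun g => if (g : Fin n → ℤ) = 0 then 0 else c g, fun g => ?_, ?_⟩
  · simp only
    split_ifs with hg
    · exact Nat.zero_le _
    by_contra! hlt
    refine hb.2 (k g • (g : Fin n → ℤ)) (mem_freePart.2 ⟨a g, (hk g).symm⟩) ?_ ?_
    · exact smul_ne_zero (hk0 g).ne' hg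
    · rw [← Finset.add_sum_erase _ _ (Finset.mem_univ g), add_sub_right_comm,
        ← Nat.sub_add_cancel hlt.le, add_smul, add_sub_cancel_right]
      exact add_mem (nsmul_mem (hGB g) _) (sum_mem fun g' _ => nsmul_mem (hGB g') _)
  · refine Finset.sum_congr rfl fun g _ => ?_
    simp only
    split_ifs with hg
    · rw [hg]; simp
    · rfl

theorem IsSimplicialFrame.finite_shifts (he : IsSimplicialFrame B e) (hB : B.FG) :
    (shifts B e).Finite := by
  have h : shifts B e = ⋃ y ∈ apery B e, {h | IsShift e (aperyClass B e y) h} := by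
    ext; simp [shifts]
  rw [h]
  exact (he.finite_apery hB).biUnion fun y hy => Set.Subsingleton.finite
    fun h hh h' hh' => (existsUnique_isShift he hy).unique hh hh'

theorem IsSimplicialFrame.isCMExtension_tilde (K : Type*) [Field K] (he : IsSimplicialFrame B e)
    (hB : B.FG) : IsCMExtension K B (tilde B e) where
  fg := (AddSubmonoid.fg_iff _).2 ⟨_, rfl, (Set.finite_range e).union (he.finite_shifts hB)⟩
  le b hb := by
    obtain ⟨x, hx, p, rfl⟩ := he.exists_eq_apery_add hb
    obtain ⟨h, hh, -⟩ := existsUnique_isShift he hx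
    obtain ⟨q, hq⟩ := hh.exists_nat he hx hb (by
      simpa using equivalent_add_sum (e := e) x fun i => (p i : ℤ))
    exact he.mem_tilde.2 ⟨h, ⟨x, hx, hh⟩, q, hq⟩
  subset_cone x hx := by
    obtain ⟨h, ⟨y, hy, hh⟩, p, rfl⟩ := he.mem_tilde.1 hx
    have := (hh.isCoords he).add_sum fun i => (p i : ℤ)
    simp only [natCast_zsmul] at this
    rw [show toRat _ = _ from this]
    refine sum_mem fun i _ => ?_
    exact PointedCone.smul_mem _ (add_nonneg (hh.coord_nonneg he i) (by positivity))
      (Submodule.subset_span ⟨_, he.mem i, rfl⟩)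
  isCohenMacaulay := by
    let ε (i : Fin d) : tilde B e :=
      ⟨e i, AddSubmonoid.subset_closure (Or.inl (Set.mem_range_self i))⟩
    refine AddMonoidAlgebra.isCohenMacaulayRing_of_bijective K ε
      (H := Subtype.val ⁻¹' shifts B e) ((he.finite_shifts hB).preimage
        Subtype.val_injective.injOn) ⟨?_, ?_⟩
    · rintro ⟨⟨h, hh⟩, p⟩ ⟨⟨h', hh'⟩, p'⟩ heq
      have := congrArg Subtype.val heq
      simp only [AddSubmonoid.coe_add, AddSubmonoid.coe_finsetSum, AddSubmonoidClass.coe_nsmul] at this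
      obtain ⟨h1, h2⟩ := he.shifts_add_injective hh hh' this
      rw [Prod.mk.injEq, Subtype.mk.injEq]
      exact ⟨Subtype.ext h1, DFunLike.coe_injective h2⟩
    · rintro ⟨x, hx⟩
      obtain ⟨h, hh, p, rfl⟩ := he.mem_tilde.1 hx
      refine ⟨⟨⟨⟨h, AddSubmonoid.subset_closure (Or.inr hh)⟩, hh⟩, Finsupp.equivFunOnFinite.symm p⟩,
        Subtype.ext ?_⟩
      simp [ε]

/-! ### Minimality of the extension -/

/-- Induction on the total size of `p` and `q`. For `i` in the support of `p` and `j` in that of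
`q`, the smaller cases put `w + e i` and `w + e j` in `S`; disjointness gives `i ≠ j`, so `H`
applies. -/
theorem mem_of_add_sum_mem_of_disjoint {S : AddSubmonoid (Fin n → ℤ)} (heS : ∀ i, e i ∈ S)
    (H : ∀ i j, i ≠ j → ∀ x, x + e i ∈ S → x + e j ∈ S → x ∈ S) {w : Fin n → ℤ}
    {p q : Fin d → ℕ} (hpq : ∀ i, p i = 0 ∨ q i = 0) (hp : w + ∑ i, p i • e i ∈ S)
    (hq : w + ∑ i, q i • e i ∈ S) : w ∈ S := by
  obtain ⟨N, hN⟩ : ∃ N, ∑ i, p i + ∑ i, q i = N := ⟨_, rfl⟩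
  induction N generalizing w p q with
  | zero =>
    have h0 : ∀ i, p i = 0 := by simpa using (Nat.add_eq_zero_iff.1 hN).1
    simpa [h0] using hp
  | succ N ih =>
    have hdec (p : Fin d → ℕ) (i : Fin d) (hi : p i ≠ 0) : ∃ p' : Fin d → ℕ,
        (∑ i, p' i) + 1 = ∑ i, p i ∧ e i + ∑ i, p' i • e i = ∑ i, p i • e i ∧
          ∀ j, p j = 0 → p' j = 0 := by
      classical
      have hp : p = Pi.single i 1 + (p - Pi.single i 1) := by
        refine (add_tsub_cancel_of_le fun j => ?_).symm
        rcases eq_or_ne j i with rfl | hj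
        · simpa using Nat.one_le_iff_ne_zero.2 hi
        · simp [hj]
      refine ⟨p - Pi.single i 1, ?_, ?_, ?_⟩
      · conv_rhs => rw [hp]
        simp only [Pi.add_apply, Finset.sum_add_distrib, Finset.sum_pi_single']
        simp [add_comm]
      · conv_rhs => rw [hp]
        simp only [Pi.add_apply, add_smul, Finset.sum_add_distrib]
        simp [Pi.single_apply, ite_smul]
      · intro j hj
        simp [hj]
    by_cases hp0 : ∀ i, p i = 0
    · simpa [hp0] using hp
    by_cases hq0 : ∀ i, q i = 0
    · simpa [hq0] using hq
    push Not at hp0 hq0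
    obtain ⟨i, hi⟩ := hp0
    obtain ⟨j, hj⟩ := hq0
    obtain ⟨p', hp1, hp2, hp3⟩ := hdec p i hi
    obtain ⟨q', hq1, hq2, hq3⟩ := hdec q j hj
    refine H i j (fun hij => ?_) w (ih (p := p') (q := q) (fun l => (hpq l).imp_left (hp3 l)) ?_ ?_
      (by omega)) (ih (p := p) (q := q') (fun l => (hpq l).imp_right (hq3 l)) ?_ ?_ (by omega))
    · subst hij
      exact (hpq i).elim hi hj
    · rwa [add_assoc, hp2]
    · rw [add_right_comm]
      exact add_mem hq (heS i)
    · rw [add_right_comm]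
      exact add_mem hp (heS j)
    · rwa [add_assoc, hq2]

theorem IsSimplicialFrame.of_le (he : IsSimplicialFrame B e) {S : AddSubmonoid (Fin n → ℤ)}
    (hBS : B ≤ S) (hS : ∀ x ∈ S, toRat x ∈ cone (B : Set (Fin n → ℤ))) :
    IsSimplicialFrame S e where
  mem i := hBS (he.mem i)
  linearIndependent := he.linearIndependent
  cone_eq := by
    rw [he.cone_eq]
    refine le_antisymm (Submodule.span_mono (Set.image_mono hBS)) (Submodule.span_le.2 ?_)
    rintro _ ⟨x, hx, rfl⟩
    exact hS x hx

theorem IsSimplicialFrame.tilde_le (K : Type*) [Field K] (he : IsSimplicialFrame B e)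
    {S : AddSubmonoid (Fin n → ℤ)} (hS : IsCMExtension K B S) : tilde B e ≤ S := by
  classical
  have heS := he.of_le hS.le hS.subset_cone
  refine AddSubmonoid.closure_le.2 (Set.union_subset ?_ ?_)
  · rintro _ ⟨i, rfl⟩
    exact heS.mem i
  rintro h ⟨y, hy, hh⟩
  -- `S` contains an element above `h` that agrees with `h` in the coordinates of `J`; for `J`
  -- everything, that element is `h`.
  have key (J : Finset (Fin d)) : ∃ p : Fin d → ℕ, (∀ i ∈ J, p i = 0) ∧ h + ∑ i, p i • e i ∈ S := by
    induction J using Finset.induction_on with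
    | empty =>
      obtain ⟨p, hp⟩ := hh.exists_nat he hy hy.1 (self_mem_aperyClass hy).2
      exact ⟨p, by simp, hp ▸ hS.le hy.1⟩
    | insert j J _ ih =>
      obtain ⟨p, hpJ, hp⟩ := ih
      obtain ⟨x, hx, hxj⟩ := hh.exists_coord_eq he j
      obtain ⟨q, rfl⟩ := hh.exists_nat he hy hx.1.1 hx.2
      have hqj : q j = 0 := by
        rw [map_add, he.coord_sum_nat] at hxj
        simpa using hxj
      -- The coordinatewise minimum keeps the zeros of `p` on `J` and gains the zero of `q` at `j`.
      -- The excesses of `p` and `q` over it have disjoint supports.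
      refine ⟨fun i => min (p i) (q i), fun i hi => ?_, ?_⟩
      · rcases Finset.mem_insert.1 hi with rfl | hi
        · simp [hqj]
        · simp [hpJ i hi]
      · refine mem_of_add_sum_mem_of_disjoint heS.mem
          (fun i j hij x => heS.mem_of_add_mem K hS.isCohenMacaulay hij)
          (p := fun i => p i - min (p i) (q i)) (q := fun i => q i - min (p i) (q i))
          (fun i => by omega) ?_ ?_
        · rw [add_assoc, ← Finset.sum_add_distrib]
          simp only [← add_smul]
          convert hp using 5
          omega
        · rw [add_assoc, ← Finset.sum_add_distrib]
          simp only [← add_smul]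
          convert hS.le hx.1.1 using 5
          omega
  obtain ⟨p, hp, hmem⟩ := key Finset.univ
  simpa [hp] using hmem

end SimplicialSemigroup

theorem theorem3p5 (K : Type*) [Field K] {n d : ℕ} (B : AddSubmonoid (Fin n → ℤ)) (hB : B.FG)
    (e : Fin d → Fin n → ℤ) (he : SimplicialSemigroup.IsSimplicialFrame B e) :
    -- the extension is an affine semigroup between `B` and `C(B)` with Cohen-Macaulay ring,
    SimplicialSemigroup.IsCMExtension K B (SimplicialSemigroup.tilde B e) ∧
    -- it is contained in every such semigroup,
    (∀ B' : AddSubmonoid (Fin n → ℤ), SimplicialSemigroup.IsCMExtension K B B' →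
      SimplicialSemigroup.tilde B e ≤ B') ∧
    -- and hence it is the unique minimal one
    (∀ B' : AddSubmonoid (Fin n → ℤ), Minimal (SimplicialSemigroup.IsCMExtension K B) B' ↔
      B' = SimplicialSemigroup.tilde B e) := by
  have h1 := he.isCMExtension_tilde K hB
  have h2 : ∀ B' : AddSubmonoid (Fin n → ℤ), SimplicialSemigroup.IsCMExtension K B B' →
      SimplicialSemigroup.tilde B e ≤ B' := fun B' hB' => he.tilde_le K hB'
  refine ⟨h1, h2, fun B' => ⟨fun h => le_antisymm (h.2 h1 (h2 B' h.1)) (h2 B' h.1), ?_⟩⟩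
  rintro rfl
  exact ⟨h1, fun B' hB' _ => h2 B' hB'⟩
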